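/- Let $\bm k$ be a field and let $\Omega$ be a commutative semigroup, written additively; sums in $\Omega$ are denoted by brackets. *Words.* Let $\mathcal H^\Omega$ be the $\bm k$-vector space spanned by the words with letters in $\Omega$ (including the empty word $\mathbf 1$), equipped with the quasi-shuffle product $*$: the bilinear product with unit $\mathbf 1$ such that $au * bv = a(u * bv) + b(au * v) + [a+b](u * v)$ for all letters $a,b$ and words $u,v$. For a nonempty word $w=\omega_1\cdots\omega_n$ put $\|w\|=[\omega_1+\cdots+\omega_n]\in\Omega$. Let $\Gamma:\mathcal H^\Omega\to\mathcal H^\Omega\otimes\mathcal H^\Omega$ be the linear map defined by $$\Gamma(w)=\sum_{s\ge 0}\ \sum_{w=w^1\cdots w^s}\|w^1\|\cdots\|w^s\|\otimes\big(w^1*\cdots* w^s\big),$$ the inner sum being over all decompositions of $w$ as a concatenation of $s$ nonempty words (so $\Gamma(\mathbf 1)=\mathbf 1\otimes\mathbf 1$). *Forests.* An $\Omega$-decorated rooted forest $F$ is a finite (possibly empty) oriented graph without cycles in which every vertex has at most one incoming edge, together with a map $d$ from its vertex set $\mathcal V(F)$ to $\Omega$. For vertices $u,v$ write $u<v$ if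 there is a nontrivial oriented path from $u$ to $v$ (so the roots are the minimal vertices). Let $\mathcal H^\Omega_<$ be the $\bm k$-vector space spanned by the isomorphism classes of $\Omega$-decorated rooted forests. A covering subforest $G$ of $F$ is a partition of $\mathcal V(F)$ into connected blocks; it is regarded as a decorated forest with the vertices and decorations of $F$ and those edges of $F$ which join two vertices of the same block. The contracted forest $F/G$ is obtained by shrinking each block to one vertex, decorated by the sum in $\Omega$ of the decorations of the vertices in the block. Let $\Gamma:\mathcal H^\Omega_<\to\mathcal H^\Omega_<\otimes\mathcal H^\Omega_<$ be the linear map defined by $$\Gamma(F)=\sum_{G\text{ covering subforest of }F}F/G\otimes G.$$ *Contracting arborification.* Let $\mathfrak a:\mathcal H^\Omega_<\to\mathcal H^\Omega$ be the linear map which sends a forest to the sum of its linear extensions with contractions allowed: $$\mathfrak a(F)=\sum_{s\ge 0}\ \sum_{\sigma}F^\sigma_1\cdots F^\sigma_s,\qquad F^\sigma_j=\Big[\sum_{\sigma(v)=j}d(v)\Big],$$ where $\sigma$ runs over all surjections $\mathcal V(F)\to\{1,\dots,s\}$ such that $\sigma(v)<\sigma(u)$ whenever $u<v$ (so the decoration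 of the root of a tree comes last). **Theorem.** The contracting arborification respects the two internal coproducts: $$\Gamma\circ\mathfrak a=(\mathfrak a\otimes\mathfrak a)\circ\Gamma .$$ -/

import Mathlib

open scoped TensorProduct

namespace Arbo

noncomputable section

/-! ### Words and the quasi-shuffle algebra -/

section Words

variable {Ω : Type*}

/-- The weight of a word: the sum of its letters, in `Ω ⊔ {0}`. -/
def weight [AddCommSemigroup Ω] (w : List Ω) : WithZero Ω :=
  (w.map (fun a : Ω => (a : WithZero Ω))).sum

theorem weight_ne_zero [AddCommSemigroup Ω] {w : List Ω} (hw : 0 < w.length) :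
    weight w ≠ 0 := by
  cases w with
  | nil => simp at hw
  | cons a l =>
    simp only [weight, List.map_cons, List.sum_cons]
    generalize (l.map (fun a : Ω => (a : WithZero Ω))).sum = x
    induction x using WithZero.recZeroCoe with
    | zero => simp
    | coe b => rw [← WithZero.coe_add]; exact WithZero.coe_ne_zero

variable (k : Type*) [Field k]

/-- The `k`-vector space spanned by the words on the alphabet `Ω`. -/
abbrev WordSpace (Ω : Type*) : Type _ := List Ω →₀ k

/-- The operator `w ↦ a w` on words, extended linearly. -/
def prepend (a : Ω) : WordSpace k Ω →ₗ[k] WordSpace k Ω :=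
  Finsupp.lmapDomain k k (List.cons a)

/-- The quasi-shuffle product of two words, by the usual recursion
`au ⧢ bv = a(u ⧢ bv) + b(au ⧢ v) + [a+b](u ⧢ v)`, with the empty word as unit. -/
def qshWord [AddCommSemigroup Ω] : List Ω → List Ω → WordSpace k Ω
  | [], v => Finsupp.single v 1
  | a :: u, [] => Finsupp.single (a :: u) 1
  | a :: u, b :: v =>
      prepend k a (qshWord u (b :: v)) + prepend k b (qshWord (a :: u) v)
        + prepend k (a + b) (qshWord u v)
  termination_by u v => u.length + v.length

/-- The quasi-shuffle product, as a bilinear map. -/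
def quasiShuffle [AddCommSemigroup Ω] :
    WordSpace k Ω →ₗ[k] WordSpace k Ω →ₗ[k] WordSpace k Ω :=
  Finsupp.linearCombination k fun u => Finsupp.linearCombination k fun v => qshWord k u v

/-- The iterated quasi-shuffle product `w¹ ⧢ ⋯ ⧢ wˢ` of a list of words
(the empty word if the list is empty). -/
def quasiShuffleList [AddCommSemigroup Ω] (L : List (List Ω)) : WordSpace k Ω :=
  L.foldr (fun w x => quasiShuffle k (Finsupp.single w 1) x) (Finsupp.single [] 1)

/-- The word `‖w¹‖ ⋯ ‖wˢ‖`, where `w = w¹ ⋯ wˢ` is the decomposition of `w` into the nonempty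
words whose lengths are given by the composition `c`. -/
def contractWord [AddCommSemigroup Ω] (w : List Ω) (c : Composition w.length) : List Ω :=
  (w.splitWrtComposition c).pmap (fun _ hb => WithZero.unzero (weight_ne_zero hb))
    (fun _ hb => List.length_pos_of_mem_splitWrtComposition hb)

/-- The decomposition coproduct of a word: the sum over all decompositions `w = w¹ ⋯ wˢ` into
nonempty words of `‖w¹‖ ⋯ ‖wˢ‖ ⊗ (w¹ ⧢ ⋯ ⧢ wˢ)`.  The empty word has the
single (empty) decomposition with `s = 0`, so it is sent to `𝟏 ⊗ 𝟏`. -/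
def wordGammaBasis [AddCommSemigroup Ω] (w : List Ω) : WordSpace k Ω ⊗[k] WordSpace k Ω :=
  ∑ c : Composition w.length,
    Finsupp.single (contractWord w c) 1 ⊗ₜ[k] quasiShuffleList k (w.splitWrtComposition c)

/-- The decomposition coproduct `Γ` on words. -/
def wordGamma (Ω : Type*) [AddCommSemigroup Ω] :
    WordSpace k Ω →ₗ[k] WordSpace k Ω ⊗[k] WordSpace k Ω :=
  Finsupp.linearCombination k (wordGammaBasis k)

end Words

/-! ### Decorated rooted forests -/

section BlockSum

variable {Ω : Type*} [AddCommSemigroup Ω] {V W : Type*}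

theorem sum_coe_ne_zero (d : V → Ω) {s : Finset V} (hs : s.Nonempty) :
    ∑ v ∈ s, (d v : WithZero Ω) ≠ 0 := by
  obtain ⟨v, hv⟩ := hs
  classical
  rw [← Finset.add_sum_erase s _ hv]
  generalize ∑ x ∈ s.erase v, (d x : WithZero Ω) = x
  induction x using WithZero.recZeroCoe with
  | zero => simp
  | coe b => rw [← WithZero.coe_add]; exact WithZero.coe_ne_zero

/-- The sum in `Ω` of the decorations `d v` over a nonempty finite set of indices `v`. -/
def blockSum (d : V → Ω) (s : Finset V) (hs : s.Nonempty) : Ω :=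
  WithZero.unzero (sum_coe_ne_zero d hs)

theorem blockSum_congr (e : V ≃ W) (d : V → Ω) (d' : W → Ω) (hd : ∀ v, d' (e v) = d v)
    (s : Finset V) (t : Finset W) (hst : ∀ v, e v ∈ t ↔ v ∈ s)
    (hs : s.Nonempty) (ht : t.Nonempty) : blockSum d s hs = blockSum d' t ht := by
  have h : ∑ v ∈ s, (d v : WithZero Ω) = ∑ v ∈ t, (d' v : WithZero Ω) :=
    Finset.sum_equiv e (fun v => (hst v).symm) (fun v _ => by rw [hd])
  unfold blockSum
  congr 1

end BlockSum

/-- An `Ω`-decorated rooted forest: a finite oriented graph without cycles in which every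
vertex has at most one incoming edge, together with a decoration of the vertices.
`edge u v` means that there is an edge from `u` to `v` (`u` is the parent of `v`). -/
structure DecForest (Ω : Type*) where
  V : Type
  [finite : Finite V]
  edge : V → V → Prop
  parent_unique : ∀ u u' v, edge u v → edge u' v → u = u'
  acyclic : ∀ v, ¬ Relation.TransGen edge v v
  dec : V → Ω

namespace DecForest

variable {Ω : Type*}

instance (F : DecForest Ω) : Finite F.V := F.finite

instance (F : DecForest Ω) : Fintype F.V := Fintype.ofFinite F.V

/-- The strict partial order on the vertices: `u < v` if there is a nontrivial oriented path
from `u` to `v`; the roots are the minimal vertices. -/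
def lt (F : DecForest Ω) : F.V → F.V → Prop := Relation.TransGen F.edge

/-- Isomorphisms of decorated rooted forests. -/
structure Iso (F F' : DecForest Ω) where
  toEquiv : F.V ≃ F'.V
  edge_iff : ∀ u v, F'.edge (toEquiv u) (toEquiv v) ↔ F.edge u v
  dec_eq : ∀ v, F'.dec (toEquiv v) = F.dec v

/-- The identity isomorphism. -/
def Iso.refl (F : DecForest Ω) : Iso F F := ⟨Equiv.refl _, fun _ _ => Iff.rfl, fun _ => rfl⟩

/-- The inverse isomorphism. -/
def Iso.symm {F F' : DecForest Ω} (e : Iso F F') : Iso F' F where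
  toEquiv := e.toEquiv.symm
  edge_iff u v := by rw [← e.edge_iff]; simp
  dec_eq v := by rw [← e.dec_eq]; simp

/-- Composition of isomorphisms. -/
def Iso.trans {F F' F'' : DecForest Ω} (e : Iso F F') (e' : Iso F' F'') : Iso F F'' where
  toEquiv := e.toEquiv.trans e'.toEquiv
  edge_iff u v := by simp [e.edge_iff, e'.edge_iff]
  dec_eq v := by simp [e.dec_eq, e'.dec_eq]

instance setoid (Ω : Type*) : Setoid (DecForest Ω) where
  r F F' := Nonempty (Iso F F')
  iseqv := ⟨fun F => ⟨Iso.refl F⟩, fun ⟨e⟩ => ⟨e.symm⟩, fun ⟨e⟩ ⟨e'⟩ => ⟨e.trans e'⟩⟩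

theorem Iso.lt_iff {F F' : DecForest Ω} (e : Iso F F') (u v : F.V) :
    F'.lt (e.toEquiv u) (e.toEquiv v) ↔ F.lt u v := by
  constructor
  · intro h
    have := Relation.TransGen.lift (p := F.edge) e.toEquiv.symm
      (fun a b hab => (e.symm.edge_iff a b).2 hab) _ _ h
    simpa [Function.onFun, lt] using this
  · exact Relation.TransGen.lift e.toEquiv (fun a b hab => (e.edge_iff a b).2 hab) _ _

/-! ### Linear extensions with contractions -/

/-- The linear extensions, with contractions allowed, of `F` onto `{1, …, s}`: the surjections
`σ` onto `Fin s` which are strictly monotone.  As words are read from the leaves to the roots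
(the root of a tree gives the last letter), monotone means `σ v < σ u` for `u < v`. -/
@[ext]
structure LinExt (F : DecForest Ω) (s : ℕ) where
  toFun : F.V → Fin s
  surjective : Function.Surjective toFun
  strict_mono : ∀ u v, F.lt u v → toFun v < toFun u

instance (F : DecForest Ω) (s : ℕ) : Finite (F.LinExt s) :=
  Finite.of_injective LinExt.toFun fun _ _ h => LinExt.ext h

instance (F : DecForest Ω) (s : ℕ) : Fintype (F.LinExt s) := Fintype.ofFinite _

section

variable [AddCommSemigroup Ω]

open Classical in
/-- The word whose `j`-th letter is the sum of the decorations of the vertices in the fibre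
over `j` of a surjection `σ`. -/
def fiberWord (F : DecForest Ω) {s : ℕ} (σ : F.V → Fin s) (hσ : Function.Surjective σ) :
    List Ω :=
  List.ofFn fun j : Fin s =>
    blockSum F.dec (Finset.univ.filter fun v => σ v = j)
      ⟨(hσ j).choose, by simp [(hσ j).choose_spec]⟩

variable (k : Type*) [Field k]

/-- The contracting arborification of a forest: the sum of all its linear extensions, with
contractions allowed. -/
def arborify (F : DecForest Ω) : WordSpace k Ω :=
  ∑ s ∈ Finset.range (Fintype.card F.V + 1),
    ∑ σ : F.LinExt s, Finsupp.single (F.fiberWord σ.toFun σ.surjective) 1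

/-- Transport of linear extensions along an isomorphism. -/
def Iso.linExt {F F' : DecForest Ω} (e : Iso F F') (s : ℕ) : F.LinExt s ≃ F'.LinExt s where
  toFun σ := ⟨σ.toFun ∘ e.toEquiv.symm, σ.surjective.comp e.toEquiv.symm.surjective,
    fun u v h => σ.strict_mono _ _ ((e.symm.lt_iff u v).2 h)⟩
  invFun σ := ⟨σ.toFun ∘ e.toEquiv, σ.surjective.comp e.toEquiv.surjective,
    fun u v h => σ.strict_mono _ _ ((e.lt_iff u v).2 h)⟩
  left_inv σ := by ext v; simp
  right_inv σ := by ext v; simp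

theorem arborify_congr {F F' : DecForest Ω} (e : Iso F F') :
    F.arborify k = F'.arborify k := by
  unfold arborify
  rw [Fintype.card_congr e.toEquiv]
  refine Finset.sum_congr rfl fun s _ => Fintype.sum_equiv (e.linExt s) _ _ fun σ => ?_
  congr 1
  unfold fiberWord
  congr 1
  funext j
  refine blockSum_congr e.toEquiv _ _ e.dec_eq _ _ (fun v => ?_) _ _
  simp only [Finset.mem_filter, Finset.mem_univ, true_and]
  simp [Iso.linExt]

end

/-! ### Covering subforests and contracted forests -/

/-- The covering subforests of `F`: partitions of the set of vertices (given as equivalence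
relations) all of whose blocks are connected, i.e. any two vertices of the same block are joined
by a (non-oriented) path of edges of `F` inside this block. -/
@[ext]
structure Covering (F : DecForest Ω) where
  rel : Setoid F.V
  connected : ∀ u v, rel u v → Relation.EqvGen (fun a b => F.edge a b ∧ rel a b) u v

instance (F : DecForest Ω) : Finite F.Covering := by
  refine Finite.of_injective (β := F.V → F.V → Prop) (fun r u v => r.rel u v) ?_
  intro r r' h
  ext u v
  exact iff_of_eq (congrFun (congrFun h u) v)

instance (F : DecForest Ω) : Fintype F.Covering := Fintype.ofFinite _

/-- A covering subforest, seen as a decorated forest: same vertices and decorations, only the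
edges inside the blocks are kept. -/
def subforest (F : DecForest Ω) (r : F.Covering) : DecForest Ω where
  V := F.V
  edge u v := F.edge u v ∧ r.rel u v
  parent_unique u u' v h h' := F.parent_unique u u' v h.1 h'.1
  acyclic v h := F.acyclic v (Relation.TransGen.mono (fun _ _ h => h.1) _ _ h)
  dec := F.dec

/-- If the parent of `b` lies outside the block of `b`, then `b` is the root of its block. -/
theorem Covering.reach {F : DecForest Ω} (r : F.Covering) {a b x : F.V} (hab : F.edge a b)
    (hr : ¬ r.rel a b) (hbx : r.rel b x) :
    Relation.ReflTransGen (fun a b => F.edge a b ∧ r.rel a b) b x := by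
  have key : ∀ x y, Relation.EqvGen (fun a b => F.edge a b ∧ r.rel a b) x y →
      (Relation.ReflTransGen (fun a b => F.edge a b ∧ r.rel a b) b x ↔
        Relation.ReflTransGen (fun a b => F.edge a b ∧ r.rel a b) b y) := by
    intro x y h
    induction h with
    | rel x y h =>
      refine ⟨fun hx => hx.tail h, fun hy => ?_⟩
      rcases hy.cases_tail with hy | ⟨z, hz, hzy⟩
      · subst hy
        exact absurd (F.parent_unique _ _ _ hab h.1 ▸ h.2) hr
      · rwa [F.parent_unique _ _ _ h.1 hzy.1]
    | refl x => exact Iff.rfl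
    | symm x y _ ih => exact ih.symm
    | trans x y z _ _ ih ih' => exact ih.trans ih'
  exact (key b x (r.connected b x hbx)).1 .refl

/-- Two vertices of the same block whose parents lie outside this block are equal. -/
theorem Covering.root_unique {F : DecForest Ω} (r : F.Covering) {a b a' b' : F.V}
    (hab : F.edge a b) (hr : ¬ r.rel a b) (hab' : F.edge a' b') (hr' : ¬ r.rel a' b')
    (hbb : r.rel b b') : b = b' := by
  rcases (r.reach hab hr hbb).cases_tail with h | ⟨z, _, hz⟩
  · exact h.symm
  · exact absurd (F.parent_unique _ _ _ hab' hz.1 ▸ hz.2) hr'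

/-- The edges of the contracted forest: two distinct blocks are joined by an edge if some of
their elements are. -/
def contractEdge (F : DecForest Ω) (r : F.Covering) (A B : Quotient r.rel) : Prop :=
  A ≠ B ∧ ∃ a b : F.V, Quotient.mk r.rel a = A ∧ Quotient.mk r.rel b = B ∧ F.edge a b

theorem contract_path (F : DecForest Ω) (r : F.Covering) {A C : Quotient r.rel}
    (h : Relation.TransGen (F.contractEdge r) A C) :
    ∃ a p c : F.V, Quotient.mk r.rel a = A ∧ Quotient.mk r.rel c = C ∧ F.edge p c ∧ ¬ r.rel p c ∧
      Relation.TransGen F.edge a c := by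
  have hne : ∀ {B D : Quotient r.rel} {b d : F.V}, B ≠ D → Quotient.mk r.rel b = B →
      Quotient.mk r.rel d = D → ¬ r.rel b d := by
    rintro B D b d h rfl rfl hbd
    exact h (Quotient.sound hbd)
  induction h with
  | single h =>
    obtain ⟨hAB, a, b, ha, hb, hab⟩ := h
    exact ⟨a, a, b, ha, hb, hab, hne hAB ha hb, .single hab⟩
  | tail _ h ih =>
    obtain ⟨a, p, c, ha, hc, hpc, hr, hac⟩ := ih
    obtain ⟨hBD, b, d, hb, hd, hbd⟩ := h
    have hcb : r.rel c b := Quotient.exact (hc.trans hb.symm)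
    have h1 : Relation.ReflTransGen F.edge c b :=
      Relation.ReflTransGen.mono (fun _ _ h => h.1) _ _ (r.reach hpc hr hcb)
    exact ⟨a, b, d, ha, hd, hbd, hne hBD hb hd, (hac.trans_left h1).tail hbd⟩

/-- Transport of covering subforests along an isomorphism. -/
def Iso.pushCovering {F F' : DecForest Ω} (e : Iso F F') (r : F.Covering) : F'.Covering where
  rel := r.rel.comap e.toEquiv.symm
  connected u v h := by
    have h' := r.connected _ _ h
    have key : ∀ x y, Relation.EqvGen (fun a b => F.edge a b ∧ r.rel a b) x y →
        Relation.EqvGen (fun a b => F'.edge a b ∧ r.rel.comap e.toEquiv.symm a b)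
          (e.toEquiv x) (e.toEquiv y) := by
      intro x y hxy
      induction hxy with
      | rel x y h =>
        refine .rel _ _ ⟨(e.edge_iff _ _).2 h.1, ?_⟩
        simpa [Setoid.comap_rel] using h.2
      | refl x => exact .refl _
      | symm x y _ ih => exact ih.symm
      | trans x y z _ _ ih ih' => exact ih.trans _ _ _ ih'
    simpa using key _ _ h'

theorem Iso.pushCovering_iff {F F' : DecForest Ω} (e : Iso F F') (r : F.Covering) (u v : F'.V) :
    (e.pushCovering r).rel u v ↔ r.rel (e.toEquiv.symm u) (e.toEquiv.symm v) := Iff.rfl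

theorem Iso.pushCovering_rel {F F' : DecForest Ω} (e : Iso F F') (r : F.Covering) (u v : F.V) :
    (e.pushCovering r).rel (e.toEquiv u) (e.toEquiv v) ↔ r.rel u v := by
  rw [e.pushCovering_iff, Equiv.symm_apply_apply, Equiv.symm_apply_apply]

/-- Transport of covering subforests along an isomorphism, as a bijection. -/
def Iso.covering {F F' : DecForest Ω} (e : Iso F F') : F.Covering ≃ F'.Covering where
  toFun := e.pushCovering
  invFun := e.symm.pushCovering
  left_inv r := by
    ext u v
    rw [e.symm.pushCovering_iff, e.pushCovering_iff]
    simp [Iso.symm]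
  right_inv r := by
    ext u v
    rw [e.pushCovering_iff, e.symm.pushCovering_iff]
    simp [Iso.symm]

/-- An isomorphism of forests induces isomorphisms of covering subforests. -/
def Iso.subforest {F F' : DecForest Ω} (e : Iso F F') (r : F.Covering) :
    Iso (F.subforest r) (F'.subforest (e.pushCovering r)) where
  toEquiv := e.toEquiv
  edge_iff u v := and_congr (e.edge_iff u v) (e.pushCovering_rel r u v)
  dec_eq := e.dec_eq

open Classical in
theorem class_nonempty (F : DecForest Ω) (r : Setoid F.V) (A : Quotient r) :
    (Finset.univ.filter fun v => Quotient.mk r v = A).Nonempty := ⟨A.out, by simp⟩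

section

variable [AddCommSemigroup Ω]

open Classical in
/-- The contracted forest: every block is shrunk onto one vertex, decorated by the sum of the
decorations of its elements. -/
def contract (F : DecForest Ω) (r : F.Covering) : DecForest Ω where
  V := Quotient r.rel
  edge := F.contractEdge r
  parent_unique := by
    rintro A A' B ⟨hA, a, b, rfl, rfl, hab⟩ ⟨hA', a', b', rfl, hb, hab'⟩
    have hr : ¬ r.rel a b := fun h => hA (Quotient.sound h)
    have hr' : ¬ r.rel a' b' := fun h => hA' ((Quotient.sound h).trans hb)
    have hbb : b = b' := r.root_unique hab hr hab' hr' (Quotient.exact hb.symm)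
    subst hbb
    rw [F.parent_unique _ _ _ hab hab']
  acyclic := by
    intro A hA
    obtain ⟨a, p, c, ha, hc, hpc, hr, hac⟩ := F.contract_path r hA
    have hca : r.rel c a := Quotient.exact (hc.trans ha.symm)
    have h1 : Relation.ReflTransGen F.edge c a :=
      Relation.ReflTransGen.mono (fun _ _ h => h.1) _ _ (r.reach hpc hr hca)
    exact F.acyclic a (hac.trans_left h1)
  dec A := blockSum F.dec (Finset.univ.filter fun v => Quotient.mk r.rel v = A)
    (F.class_nonempty r.rel A)

/-- An isomorphism of forests induces isomorphisms of contracted forests. -/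
def Iso.contract {F F' : DecForest Ω} (e : Iso F F') (r : F.Covering) :
    Iso (F.contract r) (F'.contract (e.pushCovering r)) where
  toEquiv := Quotient.congr e.toEquiv fun u v => (e.pushCovering_rel r u v).symm
  edge_iff A B := by
    refine and_congr (Equiv.injective _).ne_iff ?_
    constructor
    · rintro ⟨a, b, ha, hb, hab⟩
      refine ⟨e.toEquiv.symm a, e.toEquiv.symm b, ?_, ?_, (e.symm.edge_iff a b).2 hab⟩
      · apply (Quotient.congr e.toEquiv fun u v => (e.pushCovering_rel r u v).symm).injective
        refine Eq.trans ?_ ha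
        exact congrArg (Quotient.mk _) (e.toEquiv.apply_symm_apply a)
      · apply (Quotient.congr e.toEquiv fun u v => (e.pushCovering_rel r u v).symm).injective
        refine Eq.trans ?_ hb
        exact congrArg (Quotient.mk _) (e.toEquiv.apply_symm_apply b)
    · rintro ⟨a, b, rfl, rfl, hab⟩
      exact ⟨e.toEquiv a, e.toEquiv b, rfl, rfl, (e.edge_iff a b).2 hab⟩
  dec_eq A := by
    symm
    refine blockSum_congr e.toEquiv F.dec F'.dec e.dec_eq _ _ (fun v => ?_)
      (class_nonempty F _ A) (class_nonempty F' _ _)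
    simp only [Finset.mem_filter, Finset.mem_univ, true_and]
    exact (Quotient.congr e.toEquiv
      fun u v => (e.pushCovering_rel r u v).symm).injective.eq_iff (a := Quotient.mk r.rel v)

end

end DecForest

/-- Isomorphism classes of `Ω`-decorated rooted forests. -/
abbrev Forest (Ω : Type*) : Type _ := Quotient (DecForest.setoid Ω)

variable (k : Type*) [Field k]

/-- The `k`-vector space spanned by the (isomorphism classes of) `Ω`-decorated rooted forests,
underlying the Connes–Kreimer Hopf algebra. -/
abbrev ForestSpace (Ω : Type*) : Type _ := Forest Ω →₀ k

variable {Ω : Type*} [AddCommSemigroup Ω]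

/-- The extraction-contraction coproduct of a forest: the sum of `F/G ⊗ G` over all covering
subforests `G` of `F`. -/
def forestGammaAux (F : DecForest Ω) : ForestSpace k Ω ⊗[k] ForestSpace k Ω :=
  ∑ r : F.Covering,
    Finsupp.single (⟦F.contract r⟧ : Forest Ω) 1 ⊗ₜ[k]
      Finsupp.single (⟦F.subforest r⟧ : Forest Ω) 1

theorem forestGammaAux_congr {F F' : DecForest Ω} (e : DecForest.Iso F F') :
    forestGammaAux k F = forestGammaAux k F' := by
  refine Fintype.sum_equiv e.covering _ _ fun r => ?_
  rw [Quotient.sound (s := DecForest.setoid Ω) ⟨e.contract r⟩,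
    Quotient.sound (s := DecForest.setoid Ω) ⟨e.subforest r⟩]
  rfl

/-- The extraction-contraction coproduct `Γ` on decorated rooted forests. -/
def forestGamma (Ω : Type*) [AddCommSemigroup Ω] :
    ForestSpace k Ω →ₗ[k] ForestSpace k Ω ⊗[k] ForestSpace k Ω :=
  Finsupp.linearCombination k
    (Quotient.lift (forestGammaAux k) fun _ _ ⟨e⟩ => forestGammaAux_congr k e)

/-- The contracting arborification `𝔞`. -/
def arborification (Ω : Type*) [AddCommSemigroup Ω] : ForestSpace k Ω →ₗ[k] WordSpace k Ω :=
  Finsupp.linearCombination k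
    (Quotient.lift (DecForest.arborify k) fun _ _ ⟨e⟩ => DecForest.arborify_congr k e)

end

end Arbo

/-!
Both sides, evaluated on a forest `F`, are equal to the sum, over all surjections
`f : V(F) → {1, …, s}` with `f v ≤ f u` for every edge from `u` to `v`, of

`[dec of f⁻¹(1)] ⋯ [dec of f⁻¹(s)] ⊗ (𝔞(f⁻¹(1)) ⧢ ⋯ ⧢ 𝔞(f⁻¹(s)))`,

where each fibre carries the edges of `F` inside it.

On the side of words, cutting the word of a linear extension `σ` of `F` into `s` nonempty pieces
amounts to composing `σ` with a monotone surjection; the composite is such an `f`, and `σ` is given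
by `f` together with a linear extension of each of its fibres. This is proved one factor at a time:
`deconcat_arb` cuts off the first factor, and iterating it yields `wordGamma_arb`.

On the side of forests, a covering subforest `r` with a linear extension `τ` of `F/r` is the same as
such an `f`: compose `τ` with the projection to `F/r`, and conversely recover the blocks of `r` as
the connected components of the fibres of `f` (`pullLinExt_injective`, `exists_pullLinExt_eq`).
Since the subforest `r` is the disjoint union of the fibres of `f`, its arborification is the
quasi-shuffle product of those of the fibres, because arborification is multiplicative
(`arb_union`).

Surjections are encoded by their lists of fibres, i.e. as ordered partitions of the set of vertices,
which are generated by choosing the first block and then partitioning its complement. Only the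
edge relation enters, so the recursions run over finite sets of vertices of a fixed type.
-/

open scoped TensorProduct

namespace Arbo

noncomputable section

/-! ### The quasi-shuffle product and letters in `Ω ⊔ {0}` -/

section QuasiShuffle

variable (k : Type*) [Field k] {Ω : Type*}

/-- The operator `w ↦ a w` for `a` in `Ω ⊔ {0}`; it vanishes for `a = 0`, which is the weight
of the empty word and the decoration of the empty block. -/
def prependZ (a : WithZero Ω) : WordSpace k Ω →ₗ[k] WordSpace k Ω :=
  WithZero.recZeroCoe 0 (prepend k) a

@[simp]
theorem prependZ_zero : prependZ k (0 : WithZero Ω) = 0 := rfl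

@[simp]
theorem prependZ_coe (a : Ω) : prependZ k (a : WithZero Ω) = prepend k a := rfl

@[simp]
theorem prepend_single (a : Ω) (w : List Ω) (c : k) :
    prepend k a (Finsupp.single w c) = Finsupp.single (a :: w) c := by
  simp [prepend]

variable [AddCommSemigroup Ω]

@[simp]
theorem quasiShuffle_single (u v : List Ω) :
    quasiShuffle k (Finsupp.single u 1) (Finsupp.single v 1) = qshWord k u v := by
  simp [quasiShuffle]

@[simp]
theorem quasiShuffle_nil_left (y : WordSpace k Ω) :
    quasiShuffle k (Finsupp.single [] 1) y = y := by
  have : quasiShuffle k (Finsupp.single ([] : List Ω) 1) = LinearMap.id := by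
    ext v : 2
    simp [qshWord]
  rw [this]; rfl

@[simp]
theorem quasiShuffle_nil_right (x : WordSpace k Ω) :
    quasiShuffle k x (Finsupp.single [] 1) = x := by
  have : (quasiShuffle k (Ω := Ω)).flip (Finsupp.single [] 1) = LinearMap.id := by
    ext u : 2
    cases u <;> simp [qshWord]
  exact congrArg (fun f => f x) this

theorem quasiShuffle_prepend (a b : Ω) (x y : WordSpace k Ω) :
    quasiShuffle k (prepend k a x) (prepend k b y) =
      prepend k a (quasiShuffle k x (prepend k b y))
        + prepend k b (quasiShuffle k (prepend k a x) y)
        + prepend k (a + b) (quasiShuffle k x y) := by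
  induction x using Finsupp.induction_linear with
  | zero => simp
  | add x x' hx hx' => simp only [map_add, LinearMap.add_apply, hx, hx']; abel
  | single u c =>
    induction y using Finsupp.induction_linear with
    | zero => simp
    | add y y' hy hy' => simp only [map_add, hy, hy']; abel
    | single v c' =>
      rw [← mul_one c, ← mul_one c', ← smul_eq_mul, ← smul_eq_mul,
        ← Finsupp.smul_single, ← Finsupp.smul_single]
      simp only [map_smul, LinearMap.smul_apply, prepend_single, quasiShuffle_single]
      rw [qshWord]
      simp only [smul_add]

theorem quasiShuffle_prependZ {a b : WithZero Ω} (ha : a ≠ 0) (hb : b ≠ 0)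
    (x y : WordSpace k Ω) :
    quasiShuffle k (prependZ k a x) (prependZ k b y) =
      prependZ k a (quasiShuffle k x (prependZ k b y))
        + prependZ k b (quasiShuffle k (prependZ k a x) y)
        + prependZ k (a + b) (quasiShuffle k x y) := by
  lift a to Ω using ha
  lift b to Ω using hb
  rw [← WithZero.coe_add]
  exact quasiShuffle_prepend k a b x y

end QuasiShuffle

/-! ### Ordered set partitions -/

section OrderedPartitions

open Classical

variable {V : Type*} (ok : Finset V → Finset V → Prop)

/-- The subsets `A` of `S` such that `ok A S`. -/
def firstBlocks (S : Finset V) : Finset (Finset V) := S.powerset.filter (ok · S)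

variable {ok} in
theorem mem_firstBlocks {S A : Finset V} : A ∈ firstBlocks ok S ↔ A ⊆ S ∧ ok A S := by
  simp [firstBlocks]

/-- The ordered partitions of `S` into nonempty blocks, each of which is admissible, in the sense
of `ok`, as a first block of the union of itself and the following ones. -/
def orderedPartitions (S : Finset V) : Finset (List (Finset V)) :=
  if S = ∅ then {[]} else
    ((firstBlocks ok S).erase ∅).attach.biUnion fun A =>
      (orderedPartitions (S \ A.1)).image (List.cons A.1)
  termination_by S.card
  decreasing_by
    have hA := A.2
    rw [Finset.mem_erase, mem_firstBlocks] at hA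
    exact Finset.card_lt_card
      (Finset.sdiff_ssubset hA.2.1 (Finset.nonempty_iff_ne_empty.2 hA.1))

variable {ok}

theorem orderedPartitions_empty : orderedPartitions ok ∅ = {[]} := by
  rw [orderedPartitions, if_pos rfl]

theorem nil_mem_orderedPartitions {S : Finset V} : [] ∈ orderedPartitions ok S ↔ S = ∅ := by
  rw [orderedPartitions]
  split_ifs with h <;> simp [h]

theorem cons_mem_orderedPartitions {S A : Finset V} {L : List (Finset V)} :
    A :: L ∈ orderedPartitions ok S ↔
      A ≠ ∅ ∧ A ⊆ S ∧ ok A S ∧ L ∈ orderedPartitions ok (S \ A) := by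
  rw [orderedPartitions]
  split_ifs with h
  · subst h
    simp only [Finset.mem_singleton, reduceCtorEq, false_iff, not_and]
    exact fun h h' => absurd (Finset.subset_empty.1 h') h
  · simp only [Finset.mem_biUnion, Finset.mem_attach, true_and, Subtype.exists, Finset.mem_erase,
      mem_firstBlocks, Finset.mem_image, List.cons.injEq]
    constructor
    · rintro ⟨B, ⟨h1, h2, h3⟩, M, hM, rfl, rfl⟩
      exact ⟨h1, h2, h3, hM⟩
    · rintro ⟨h1, h2, h3, h4⟩
      exact ⟨A, ⟨h1, h2, h3⟩, L, h4, rfl, rfl⟩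

theorem sum_orderedPartitions {M : Type*} [AddCommMonoid M] {S : Finset V} (hS : S.Nonempty)
    (g : List (Finset V) → M) :
    ∑ L ∈ orderedPartitions ok S, g L =
      ∑ A ∈ (firstBlocks ok S).erase ∅, ∑ L ∈ orderedPartitions ok (S \ A), g (A :: L) := by
  rw [orderedPartitions, if_neg hS.ne_empty, Finset.sum_biUnion]
  · rw [← Finset.sum_attach ((firstBlocks ok S).erase ∅)]
    refine Finset.sum_congr rfl fun A _ => Finset.sum_image ?_
    exact fun _ _ _ _ h => (List.cons.inj h).2
  · intro A _ B _ hAB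
    rw [Function.onFun, Finset.disjoint_left]
    intro L hA hB
    obtain ⟨M, -, rfl⟩ := Finset.mem_image.1 hA
    obtain ⟨N, -, h⟩ := Finset.mem_image.1 hB
    exact hAB (Subtype.ext (List.cons.inj h).1.symm)

end OrderedPartitions

/-! ### Words of the ordered partitions compatible with a relation -/

section RelWord

open Classical

variable {V : Type*} (r : V → V → Prop)

/-- No element of `A` is below an element of `S`. -/
def IsTop (A S : Finset V) : Prop := ∀ u ∈ A, ∀ v ∈ S, ¬ r u v

/-- `A` contains every element of `S` which is above an element of `A`. -/
def IsUp (A S : Finset V) : Prop := ∀ u ∈ A, ∀ v ∈ S, r u v → v ∈ A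

variable (k : Type*) [Field k] {Ω : Type*} [AddCommSemigroup Ω] (d : V → Ω)

/-- The decoration of a block, in `Ω ⊔ {0}`. -/
def blockWeight (A : Finset V) : WithZero Ω := ∑ v ∈ A, (d v : WithZero Ω)

/-- The word whose letters are the decorations of the blocks of a list. -/
def blocksWord (L : List (Finset V)) : WordSpace k Ω :=
  L.foldr (fun A => prependZ k (blockWeight d A)) (Finsupp.single [] 1)

/-- The contracting arborification of a finite set `S` of vertices for an arbitrary relation `r`:
the sum of the words of all ordered partitions of `S` such that `r u v` forces the block of `v`
to be strictly before that of `u`. -/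
def arb (S : Finset V) : WordSpace k Ω :=
  ∑ L ∈ orderedPartitions (IsTop r) S, blocksWord k d L

theorem arb_empty : arb r k d ∅ = Finsupp.single [] 1 := by
  simp [arb, orderedPartitions_empty, blocksWord]

/-- The recursion on the first block, that is, on the first letter of the words. -/
theorem arb_of_nonempty {S : Finset V} (hS : S.Nonempty) :
    arb r k d S = ∑ A ∈ (firstBlocks (IsTop r) S).erase ∅,
      prependZ k (blockWeight d A) (arb r k d (S \ A)) := by
  rw [arb, sum_orderedPartitions hS]
  refine Finset.sum_congr rfl fun A _ => ?_
  rw [arb, map_sum]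
  rfl

theorem blockWeight_empty : blockWeight d ∅ = 0 := by simp [blockWeight]

theorem blockWeight_union {A B : Finset V} (h : Disjoint A B) :
    blockWeight d (A ∪ B) = blockWeight d A + blockWeight d B := Finset.sum_union h

variable {r}

theorem empty_mem_firstBlocks_isTop (S : Finset V) : ∅ ∈ firstBlocks (IsTop r) S := by
  simp [mem_firstBlocks, IsTop]

theorem empty_mem_firstBlocks_isUp (S : Finset V) : ∅ ∈ firstBlocks (IsUp r) S := by
  simp [mem_firstBlocks, IsUp]

/-- The empty first block may be included in the recursion: it contributes `0`. -/
theorem arb_eq_sum_firstBlocks {S : Finset V} (hS : S.Nonempty) :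
    arb r k d S = ∑ A ∈ firstBlocks (IsTop r) S,
      prependZ k (blockWeight d A) (arb r k d (S \ A)) := by
  rw [← Finset.insert_erase (empty_mem_firstBlocks_isTop (r := r) S),
    Finset.sum_insert (Finset.notMem_erase _ _), ← arb_of_nonempty r k d hS, blockWeight_empty]
  simp

theorem arb_congr {r' : V → V → Prop} {S : Finset V}
    (h : ∀ u ∈ S, ∀ v ∈ S, (r u v ↔ r' u v)) : arb r k d S = arb r' k d S := by
  induction S using Finset.strongInduction with
  | H S ih =>
    rcases S.eq_empty_or_nonempty with rfl | hS
    · rw [arb_empty, arb_empty]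
    · rw [arb_of_nonempty r k d hS, arb_of_nonempty r' k d hS]
      have h1 : firstBlocks (IsTop r) S = firstBlocks (IsTop r') S := by
        ext A
        rw [mem_firstBlocks, mem_firstBlocks]
        refine and_congr_right fun hA => ?_
        exact forall₂_congr fun u hu => forall₂_congr fun v hv => not_congr (h u (hA hu) v hv)
      rw [h1]
      refine Finset.sum_congr rfl fun A hA => ?_
      rw [Finset.mem_erase, mem_firstBlocks] at hA
      rw [ih _ (Finset.sdiff_ssubset hA.2.1 (Finset.nonempty_iff_ne_empty.2 hA.1))]
      exact fun u hu v hv => h u (Finset.sdiff_subset hu) v (Finset.sdiff_subset hv)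

theorem blockWeight_ne_zero {A : Finset V} (hA : A ≠ ∅) : blockWeight d A ≠ 0 :=
  sum_coe_ne_zero d (Finset.nonempty_iff_ne_empty.2 hA)

/-- The arborification is multiplicative: a first block of a disjoint union is the union of two
possibly empty first blocks, and the cases where the second, the first or none of them is empty
are the three terms of the recursion of the quasi-shuffle product. -/
theorem arb_union {S T : Finset V} (hST : Disjoint S T)
    (h : ∀ u ∈ S, ∀ v ∈ T, ¬ r u v ∧ ¬ r v u) :
    arb r k d (S ∪ T) = quasiShuffle k (arb r k d S) (arb r k d T) := by
  induction hn : S.card + T.card using Nat.strong_induction_on generalizing S T with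
  | h n ih =>
    subst hn
    rcases S.eq_empty_or_nonempty with rfl | hS
    · simp [arb_empty]
    rcases T.eq_empty_or_nonempty with rfl | hT
    · simp [arb_empty]
    -- The pairs `(A, B)` include those with an empty entry; the pair `(∅, ∅)` contributes `0`,
    -- as `prependZ` vanishes on the weight of the empty block.
    have key : arb r k d (S ∪ T) =
        ∑ A ∈ firstBlocks (IsTop r) S, ∑ B ∈ firstBlocks (IsTop r) T,
          prependZ k (blockWeight d A + blockWeight d B)
            (arb r k d ((S \ A) ∪ (T \ B))) := by
      rw [arb_eq_sum_firstBlocks k d (hS.mono Finset.subset_union_left), ← Finset.sum_product']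
      refine Finset.sum_bij' (fun C _ => (C ∩ S, C ∩ T)) (fun p _ => p.1 ∪ p.2) ?_ ?_ ?_ ?_ ?_
      · intro C hC
        rw [mem_firstBlocks] at hC
        simp only [Finset.mem_product, mem_firstBlocks]
        exact ⟨⟨Finset.inter_subset_right, fun u hu v hv =>
          hC.2 u (Finset.mem_inter.1 hu).1 v (Finset.mem_union_left _ hv)⟩,
          ⟨Finset.inter_subset_right, fun u hu v hv =>
          hC.2 u (Finset.mem_inter.1 hu).1 v (Finset.mem_union_right _ hv)⟩⟩
      · rintro ⟨A, B⟩ hp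
        simp only [Finset.mem_product, mem_firstBlocks] at hp
        rw [mem_firstBlocks]
        refine ⟨Finset.union_subset_union hp.1.1 hp.2.1, fun u hu v hv => ?_⟩
        rcases Finset.mem_union.1 hu with hu | hu <;> rcases Finset.mem_union.1 hv with hv | hv
        · exact hp.1.2 u hu v hv
        · exact (h u (hp.1.1 hu) v hv).1
        · exact (h v hv u (hp.2.1 hu)).2
        · exact hp.2.2 u hu v hv
      · intro C hC
        rw [mem_firstBlocks] at hC
        simp only
        rw [← Finset.inter_union_distrib_left, Finset.inter_eq_left.2 hC.1]
      · rintro ⟨A, B⟩ hp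
        simp only [Finset.mem_product, mem_firstBlocks] at hp
        have h1 : Disjoint B S := (hST.mono_right hp.2.1).symm
        have h2 : Disjoint A T := hST.mono_left hp.1.1
        simp only [Finset.union_inter_distrib_right, Finset.inter_eq_left.2 hp.1.1,
          Finset.inter_eq_left.2 hp.2.1, Finset.disjoint_iff_inter_eq_empty.1 h1,
          Finset.disjoint_iff_inter_eq_empty.1 h2, Finset.union_empty, Finset.empty_union]
      · intro C hC
        rw [mem_firstBlocks] at hC
        have h1 : C = (C ∩ S) ∪ (C ∩ T) := by
          rw [← Finset.inter_union_distrib_left, Finset.inter_eq_left.2 hC.1]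
        have h2 : (S ∪ T) \ C = (S \ (C ∩ S)) ∪ (T \ (C ∩ T)) := by
          ext v; simp only [Finset.mem_sdiff, Finset.mem_union, Finset.mem_inter]; tauto
        have h3 : blockWeight d C = blockWeight d (C ∩ S) + blockWeight d (C ∩ T) := by
          conv_lhs => rw [h1]
          exact blockWeight_union d (hST.mono Finset.inter_subset_right Finset.inter_subset_right)
        rw [h2, h3]
    have hrest : ∀ A ∈ firstBlocks (IsTop r) S, ∀ B ∈ firstBlocks (IsTop r) T,
        (A ≠ ∅ ∨ B ≠ ∅) → arb r k d ((S \ A) ∪ (T \ B)) =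
          quasiShuffle k (arb r k d (S \ A)) (arb r k d (T \ B)) := by
      intro A hA B hB hAB
      rw [mem_firstBlocks] at hA hB
      refine ih _ ?_ (hST.mono Finset.sdiff_subset Finset.sdiff_subset)
        (fun u hu v hv => h u (Finset.sdiff_subset hu) v (Finset.sdiff_subset hv)) rfl
      rcases hAB with hne | hne
      · exact add_lt_add_of_lt_of_le (Finset.card_lt_card
          (Finset.sdiff_ssubset hA.1 (Finset.nonempty_iff_ne_empty.2 hne)))
          (Finset.card_le_card Finset.sdiff_subset)
      · exact add_lt_add_of_le_of_lt (Finset.card_le_card Finset.sdiff_subset)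
          (Finset.card_lt_card
          (Finset.sdiff_ssubset hB.1 (Finset.nonempty_iff_ne_empty.2 hne)))
    have hS0 := empty_mem_firstBlocks_isTop (r := r) S
    have hT0 := empty_mem_firstBlocks_isTop (r := r) T
    have hprod : quasiShuffle k (arb r k d S) (arb r k d T) =
        ∑ A ∈ (firstBlocks (IsTop r) S).erase ∅, ∑ B ∈ (firstBlocks (IsTop r) T).erase ∅,
          (prependZ k (blockWeight d A) (quasiShuffle k (arb r k d (S \ A))
              (prependZ k (blockWeight d B) (arb r k d (T \ B))))
            + prependZ k (blockWeight d B) (quasiShuffle k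
              (prependZ k (blockWeight d A) (arb r k d (S \ A))) (arb r k d (T \ B)))
            + prependZ k (blockWeight d A + blockWeight d B)
              (quasiShuffle k (arb r k d (S \ A)) (arb r k d (T \ B)))) := by
      rw [arb_of_nonempty r k d hS, arb_of_nonempty r k d hT]
      simp only [map_sum, LinearMap.sum_apply]
      rw [Finset.sum_comm]
      refine Finset.sum_congr rfl fun A hA => Finset.sum_congr rfl fun B hB => ?_
      exact quasiShuffle_prependZ k (blockWeight_ne_zero d (Finset.mem_erase.1 hA).1)
        (blockWeight_ne_zero d (Finset.mem_erase.1 hB).1) _ _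
    -- The sum over `B` of the first terms reassembles the arborification of `T`, so that these
    -- terms account for the pairs `(A, ∅)`; symmetrically for the second terms and `(∅, B)`.
    have h1 : ∑ A ∈ (firstBlocks (IsTop r) S).erase ∅, ∑ B ∈ (firstBlocks (IsTop r) T).erase ∅,
        prependZ k (blockWeight d A) (quasiShuffle k (arb r k d (S \ A))
          (prependZ k (blockWeight d B) (arb r k d (T \ B)))) =
        ∑ A ∈ (firstBlocks (IsTop r) S).erase ∅,
          prependZ k (blockWeight d A) (arb r k d ((S \ A) ∪ T)) := by
      refine Finset.sum_congr rfl fun A hA => ?_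
      have := hrest A (Finset.mem_of_mem_erase hA) ∅ hT0 (.inl (Finset.mem_erase.1 hA).1)
      rw [Finset.sdiff_empty] at this
      rw [this, arb_of_nonempty r k d hT]
      simp only [map_sum]
    have h2 : ∑ A ∈ (firstBlocks (IsTop r) S).erase ∅, ∑ B ∈ (firstBlocks (IsTop r) T).erase ∅,
        prependZ k (blockWeight d B) (quasiShuffle k
          (prependZ k (blockWeight d A) (arb r k d (S \ A))) (arb r k d (T \ B))) =
        ∑ B ∈ (firstBlocks (IsTop r) T).erase ∅,
          prependZ k (blockWeight d B) (arb r k d (S ∪ (T \ B))) := by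
      rw [Finset.sum_comm]
      refine Finset.sum_congr rfl fun B hB => ?_
      have := hrest ∅ hS0 B (Finset.mem_of_mem_erase hB) (.inr (Finset.mem_erase.1 hB).1)
      rw [Finset.sdiff_empty] at this
      rw [this, arb_of_nonempty r k d hS]
      simp only [map_sum, LinearMap.sum_apply]
    have h3 : ∑ A ∈ (firstBlocks (IsTop r) S).erase ∅, ∑ B ∈ (firstBlocks (IsTop r) T).erase ∅,
        prependZ k (blockWeight d A + blockWeight d B)
          (quasiShuffle k (arb r k d (S \ A)) (arb r k d (T \ B))) =
        ∑ A ∈ (firstBlocks (IsTop r) S).erase ∅, ∑ B ∈ (firstBlocks (IsTop r) T).erase ∅,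
        prependZ k (blockWeight d A + blockWeight d B) (arb r k d ((S \ A) ∪ (T \ B))) := by
      refine Finset.sum_congr rfl fun A hA => Finset.sum_congr rfl fun B hB => ?_
      rw [hrest A (Finset.mem_of_mem_erase hA) B (Finset.mem_of_mem_erase hB)
        (.inl (Finset.mem_erase.1 hA).1)]
    rw [hprod, key]
    simp only [Finset.sum_add_distrib]
    rw [h1, h2, h3, ← Finset.insert_erase hS0, Finset.sum_insert (Finset.notMem_erase _ _),
      ← Finset.insert_erase hT0, Finset.sum_insert (Finset.notMem_erase _ _)]
    simp only [Finset.sum_insert (Finset.notMem_erase _ _), Finset.sum_add_distrib,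
      blockWeight_empty, zero_add, add_zero, Finset.sdiff_empty, prependZ_zero,
      LinearMap.zero_apply, Finset.erase_insert_eq_erase, Finset.erase_idem]
    abel

end RelWord

/-! ### The decomposition coproduct of words, one factor at a time -/

section WordGamma

/-- A decomposition of a nonempty word is a nonempty prefix and a decomposition of the rest. -/
theorem sum_splitWrtComposition {α M : Type*} [AddCommMonoid M] {w : List α} (hw : w ≠ [])
    (g : List (List α) → M) :
    ∑ c : Composition w.length, g (w.splitWrtComposition c) =
      ∑ i ∈ Finset.range w.length, ∑ c : Composition (w.drop (i + 1)).length,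
        g (w.take (i + 1) :: (w.drop (i + 1)).splitWrtComposition c) := by
  symm
  rw [Finset.sum_sigma']
  have hle : ∀ p ∈ (Finset.range w.length).sigma
      fun i => (Finset.univ : Finset (Composition (w.drop (i + 1)).length)), p.1 < w.length := by
    intro p hp
    simpa using hp
  refine Finset.sum_bij (fun p hp => ⟨(p.1 + 1) :: p.2.blocks, ?_, ?_⟩) ?_ ?_ ?_ ?_
  · intro i hi
    rcases List.mem_cons.1 hi with rfl | hi
    · exact Nat.succ_pos _
    · exact p.2.blocks_pos hi
  · have := hle p hp
    rw [List.sum_cons, p.2.blocks_sum, List.length_drop]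
    omega
  · exact fun _ _ => Finset.mem_univ _
  · rintro ⟨i, c⟩ _ ⟨j, c'⟩ _ h
    have h' := congrArg Composition.blocks h
    obtain ⟨h1, h2⟩ := List.cons.inj h'
    obtain rfl : i = j := Nat.succ_injective h1
    obtain rfl : c = c' := Composition.ext h2
    rfl
  · rintro ⟨_ | ⟨n, l⟩, hpos, hsum⟩ _
    · rw [List.sum_nil] at hsum
      exact absurd (List.length_eq_zero_iff.1 hsum.symm) hw
    · have hn : 0 < n := hpos (by simp)
      obtain ⟨i, rfl⟩ : ∃ i, n = i + 1 := ⟨n - 1, by omega⟩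
      rw [List.sum_cons] at hsum
      refine ⟨⟨i, ⟨l, fun {j} hj => hpos (List.mem_cons_of_mem _ hj), ?_⟩⟩, ?_, rfl⟩
      · rw [List.length_drop]; omega
      · simp only [Finset.mem_sigma, Finset.mem_range, Finset.mem_univ, and_true]
        omega
  · rintro ⟨i, c⟩ _
    simp only [List.splitWrtComposition, List.splitWrtCompositionAux_cons]

variable (k : Type*) [Field k] {Ω : Type*}

/-- The deconcatenation coproduct `w ↦ ∑ u ⊗ v` over all decompositions `w = u v`. -/
def deconcat : WordSpace k Ω →ₗ[k] WordSpace k Ω ⊗[k] WordSpace k Ω :=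
  Finsupp.linearCombination k fun w => ∑ i ∈ Finset.range (w.length + 1),
    Finsupp.single (w.take i) 1 ⊗ₜ[k] Finsupp.single (w.drop i) 1

theorem deconcat_single (w : List Ω) :
    deconcat k (Finsupp.single w 1) = ∑ i ∈ Finset.range (w.length + 1),
      Finsupp.single (w.take i) 1 ⊗ₜ[k] Finsupp.single (w.drop i) 1 := by
  simp [deconcat]

theorem deconcat_prepend (a : Ω) (x : WordSpace k Ω) :
    deconcat k (prepend k a x) = Finsupp.single [] 1 ⊗ₜ[k] prepend k a x +
      TensorProduct.map (prepend k a) LinearMap.id (deconcat k x) := by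
  have : deconcat k ∘ₗ prepend k a =
      TensorProduct.mk k _ _ (Finsupp.single [] 1) ∘ₗ prepend k a +
        TensorProduct.map (prepend k a) LinearMap.id ∘ₗ deconcat k := by
    ext w : 2
    simp only [LinearMap.comp_apply, Finsupp.lsingle_apply, LinearMap.add_apply, prepend_single,
      deconcat_single, TensorProduct.mk_apply, map_sum, TensorProduct.map_tmul,
      LinearMap.id_apply, List.length_cons]
    rw [Finset.sum_range_succ', add_comm]
    simp
  exact congrArg (fun f => f x) this

theorem deconcat_prependZ {a : WithZero Ω} (ha : a ≠ 0) (x : WordSpace k Ω) :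
    deconcat k (prependZ k a x) = Finsupp.single [] 1 ⊗ₜ[k] prependZ k a x +
      TensorProduct.map (prependZ k a) LinearMap.id (deconcat k x) := by
  lift a to Ω using ha
  exact deconcat_prepend k a x

variable [AddCommSemigroup Ω]

theorem weight_cons (a : Ω) (w : List Ω) : weight (a :: w) = a + weight w := rfl

/-- The operator by which a first factor `u` contributes to the decomposition coproduct: it
prepends the letter `‖u‖` on the left and multiplies by `u` on the right. -/
def factorOp : WordSpace k Ω →ₗ[k]
    (WordSpace k Ω ⊗[k] WordSpace k Ω →ₗ[k] WordSpace k Ω ⊗[k] WordSpace k Ω) :=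
  Finsupp.linearCombination k fun u =>
    TensorProduct.map (prependZ k (weight u)) (quasiShuffle k (Finsupp.single u 1))

@[simp]
theorem factorOp_single (u : List Ω) :
    factorOp k (Finsupp.single u 1) =
      TensorProduct.map (prependZ k (weight u)) (quasiShuffle k (Finsupp.single u 1)) := by
  simp [factorOp]

theorem factorOp_nil : factorOp k (Finsupp.single ([] : List Ω) 1) = 0 := by
  rw [factorOp_single]
  ext
  simp [weight]

theorem tmul_eq_foldr_factorOp (L : List (List Ω)) (hL : ∀ u ∈ L, 0 < u.length) :
    Finsupp.single (L.pmap (fun _ hb => WithZero.unzero (weight_ne_zero hb)) hL) 1 ⊗ₜ[k]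
        quasiShuffleList k L =
      L.foldr (fun u => factorOp k (Finsupp.single u 1))
        (Finsupp.single [] 1 ⊗ₜ[k] Finsupp.single [] 1) := by
  induction L with
  | nil => rfl
  | cons u L ih =>
    have hu : weight u ≠ 0 := weight_ne_zero (hL u (by simp))
    rw [List.foldr_cons, ← ih fun v hv => hL v (List.mem_cons_of_mem _ hv), factorOp_single,
      TensorProduct.map_tmul]
    congr 1
    conv_rhs => rw [← WithZero.coe_unzero hu]
    rw [prependZ_coe, prepend_single]
    rfl

theorem wordGammaBasis_eq (w : List Ω) :
    wordGammaBasis k w = ∑ c : Composition w.length,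
      (w.splitWrtComposition c).foldr (fun u => factorOp k (Finsupp.single u 1))
        (Finsupp.single [] 1 ⊗ₜ[k] Finsupp.single [] 1) :=
  Finset.sum_congr rfl fun _ _ => tmul_eq_foldr_factorOp k _ _

theorem wordGammaBasis_nil :
    wordGammaBasis k ([] : List Ω) = Finsupp.single [] 1 ⊗ₜ[k] Finsupp.single [] 1 := by
  have : ∀ c : Composition ([] : List Ω).length, ([] : List Ω).splitWrtComposition c = [] := by
    intro c
    have hc : c.blocks = [] := c.blocks_eq_nil.2 rfl
    rw [List.splitWrtComposition, hc]
    rfl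
  rw [wordGammaBasis_eq]
  simp only [this, List.foldr_nil, Finset.sum_const, Finset.card_univ, composition_card]
  simp

theorem wordGammaBasis_of_ne_nil {w : List Ω} (hw : w ≠ []) :
    wordGammaBasis k w = ∑ i ∈ Finset.range w.length,
      factorOp k (Finsupp.single (w.take (i + 1)) 1) (wordGammaBasis k (w.drop (i + 1))) := by
  rw [wordGammaBasis_eq, sum_splitWrtComposition hw]
  refine Finset.sum_congr rfl fun i _ => ?_
  rw [wordGammaBasis_eq, map_sum]
  rfl

/-- The decomposition coproduct of a combination of nonempty words is obtained by splitting off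
the first factor by deconcatenation; the empty first factor does not contribute. -/
theorem wordGamma_prepend (a : Ω) (x : WordSpace k Ω) :
    wordGamma k Ω (prepend k a x) =
      TensorProduct.lift ((factorOp k).compl₂ (wordGamma k Ω)) (deconcat k (prepend k a x)) := by
  have : wordGamma k Ω ∘ₗ prepend k a =
      TensorProduct.lift ((factorOp k).compl₂ (wordGamma k Ω)) ∘ₗ deconcat k ∘ₗ prepend k a := by
    ext w : 2
    have hΓ : ∀ v : List Ω, wordGamma k Ω (Finsupp.single v 1) = wordGammaBasis k v := by
      intro v; simp [wordGamma]
    simp only [LinearMap.comp_apply, Finsupp.lsingle_apply, prepend_single, deconcat_single,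
      map_sum, TensorProduct.lift.tmul, LinearMap.compl₂_apply, hΓ]
    rw [wordGammaBasis_of_ne_nil k (by simp), Finset.sum_range_succ' _ (a :: w).length,
      List.take_zero, factorOp_nil, LinearMap.zero_apply, add_zero]
  exact congrArg (fun f => f x) this

theorem wordGamma_prependZ (a : WithZero Ω) (x : WordSpace k Ω) :
    wordGamma k Ω (prependZ k a x) =
      TensorProduct.lift ((factorOp k).compl₂ (wordGamma k Ω)) (deconcat k (prependZ k a x)) := by
  induction a using WithZero.recZeroCoe with
  | zero => simp
  | coe a => exact wordGamma_prepend k a x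

end WordGamma

/-! ### The decomposition coproduct of an arborification -/

section GammaArb

open Classical

variable {V : Type*} (r : V → V → Prop) (k : Type*) [Field k] {Ω : Type*} [AddCommSemigroup Ω]
  (d : V → Ω)

/-- An ordered partition of `S` into top parts, cut in two pieces, is a pair of such partitions
of an upper set and of its complement. -/
theorem deconcat_arb (S : Finset V) :
    deconcat k (arb r k d S) =
      ∑ U ∈ firstBlocks (IsUp r) S, arb r k d U ⊗ₜ[k] arb r k d (S \ U) := by
  induction S using Finset.strongInduction with
  | H S ih =>
    rcases S.eq_empty_or_nonempty with rfl | hS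
    · have : firstBlocks (IsUp r) (∅ : Finset V) = {∅} := by
        ext A
        rw [mem_firstBlocks, Finset.subset_empty, Finset.mem_singleton]
        exact ⟨fun h => h.1, fun h => ⟨h, by simp [IsUp]⟩⟩
      rw [this]
      simp [arb_empty, deconcat_single]
    · have h1 : deconcat k (arb r k d S) = Finsupp.single [] 1 ⊗ₜ[k] arb r k d S +
          ∑ A ∈ (firstBlocks (IsTop r) S).erase ∅, ∑ U ∈ firstBlocks (IsUp r) (S \ A),
            prependZ k (blockWeight d A) (arb r k d U) ⊗ₜ[k] arb r k d ((S \ A) \ U) := by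
        rw [arb_of_nonempty r k d hS, map_sum, TensorProduct.tmul_sum, ← Finset.sum_add_distrib]
        refine Finset.sum_congr rfl fun A hA => ?_
        rw [Finset.mem_erase, mem_firstBlocks] at hA
        rw [deconcat_prependZ k (blockWeight_ne_zero d hA.1),
          ih _ (Finset.sdiff_ssubset hA.2.1 (Finset.nonempty_iff_ne_empty.2 hA.1)), map_sum]
        simp only [TensorProduct.map_tmul, LinearMap.id_apply]
      have h2 : ∑ U ∈ (firstBlocks (IsUp r) S).erase ∅, arb r k d U ⊗ₜ[k] arb r k d (S \ U) =
          ∑ U ∈ (firstBlocks (IsUp r) S).erase ∅, ∑ A ∈ (firstBlocks (IsTop r) U).erase ∅,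
            prependZ k (blockWeight d A) (arb r k d (U \ A)) ⊗ₜ[k] arb r k d (S \ U) := by
        refine Finset.sum_congr rfl fun U hU => ?_
        rw [arb_of_nonempty r k d (Finset.nonempty_iff_ne_empty.2 (Finset.mem_erase.1 hU).1),
          TensorProduct.sum_tmul]
      rw [h1, ← Finset.insert_erase (empty_mem_firstBlocks_isUp (r := r) S),
        Finset.sum_insert (Finset.notMem_erase _ _), arb_empty, Finset.sdiff_empty, h2,
        Finset.sum_sigma', Finset.sum_sigma']
      congr 1
      -- A top part `A` of `S` and an upper set `U` of `S \ A` correspond to the upper set `A ∪ U`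
      -- of `S` together with its top part `A`.
      refine Finset.sum_bij' (fun p _ => ⟨p.1 ∪ p.2, p.1⟩) (fun p _ => ⟨p.2, p.1 \ p.2⟩)
        ?_ ?_ ?_ ?_ ?_
      · rintro ⟨A, U⟩ h
        simp only [Finset.mem_sigma, Finset.mem_erase, mem_firstBlocks] at h ⊢
        obtain ⟨⟨hne, hAS, hA⟩, hUS, hU⟩ := h
        have hsub : A ∪ U ⊆ S := Finset.union_subset hAS (hUS.trans Finset.sdiff_subset)
        refine ⟨⟨?_, hsub, ?_⟩, hne, Finset.subset_union_left,
          fun u hu v hv => hA u hu v (hsub hv)⟩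
        · exact fun h => hne (Finset.subset_empty.1 (h ▸ Finset.subset_union_left))
        · intro u hu v hv huv
          rcases Finset.mem_union.1 hu with hu | hu
          · exact absurd huv (hA u hu v hv)
          · by_cases hvA : v ∈ A
            · exact Finset.mem_union_left _ hvA
            · exact Finset.mem_union_right _ (hU u hu v (Finset.mem_sdiff.2 ⟨hv, hvA⟩) huv)
      · rintro ⟨U, A⟩ h
        simp only [Finset.mem_sigma, Finset.mem_erase, mem_firstBlocks] at h ⊢
        obtain ⟨⟨-, hUS, hU⟩, hne, hAU, hA⟩ := h
        refine ⟨⟨hne, hAU.trans hUS, fun u hu v hv huv => ?_⟩,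
          Finset.sdiff_subset_sdiff hUS subset_rfl, fun u hu v hv huv => ?_⟩
        · exact hA u hu v (hU u (hAU hu) v hv huv) huv
        · rw [Finset.mem_sdiff] at hu hv ⊢
          exact ⟨hU u hu.1 v hv.1 huv, hv.2⟩
      · rintro ⟨A, U⟩ h
        simp only [Finset.mem_sigma, Finset.mem_erase, mem_firstBlocks] at h
        have hdis : Disjoint U A := Finset.disjoint_of_subset_left h.2.1 Finset.sdiff_disjoint
        simp only [Finset.union_sdiff_cancel_left hdis.symm]
      · rintro ⟨U, A⟩ h
        simp only [Finset.mem_sigma, Finset.mem_erase, mem_firstBlocks] at h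
        simp only [Finset.union_sdiff_of_subset h.2.2.1]
      · rintro ⟨A, U⟩ h
        simp only [Finset.mem_sigma, Finset.mem_erase, mem_firstBlocks] at h
        have hdis : Disjoint U A := Finset.disjoint_of_subset_left h.2.1 Finset.sdiff_disjoint
        simp only [Finset.union_sdiff_cancel_left hdis.symm, sdiff_sdiff_left, Finset.sup_eq_union]

/-- All the words of the arborification of `S` have the weight of `S`, so the letter prepended by
`factorOp` is the same for all of them. -/
theorem factorOp_arb (S : Finset V) :
    factorOp k (arb r k d S) =
      TensorProduct.map (prependZ k (blockWeight d S)) (quasiShuffle k (arb r k d S)) := by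
  have hmem : arb r k d S ∈ Finsupp.supported k k {w | weight w = blockWeight d S} := by
    induction S using Finset.strongInduction with
    | H S ih =>
      rcases S.eq_empty_or_nonempty with rfl | hS
      · rw [arb_empty]
        exact Finsupp.single_mem_supported k _ (by simp [weight, blockWeight])
      · rw [arb_of_nonempty r k d hS]
        refine Submodule.sum_mem _ fun A hA => ?_
        rw [Finset.mem_erase, mem_firstBlocks] at hA
        have h1 := ih _ (Finset.sdiff_ssubset hA.2.1 (Finset.nonempty_iff_ne_empty.2 hA.1))
        have h2 : blockWeight d S = blockWeight d A + blockWeight d (S \ A) := by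
          rw [← blockWeight_union d Finset.disjoint_sdiff, Finset.union_sdiff_of_subset hA.2.1]
        rw [h2]
        generalize blockWeight d A = a, blockWeight d (S \ A) = b, arb r k d (S \ A) = x at h1 ⊢
        induction a using WithZero.recZeroCoe with
        | zero => simp
        | coe a =>
          rw [Finsupp.supported_eq_span_single] at h1
          rw [prependZ_coe]
          induction h1 using Submodule.span_induction with
          | mem x hx =>
            obtain ⟨w, hw, rfl⟩ := hx
            rw [prepend_single]
            exact Finsupp.single_mem_supported k _ (by
              rw [Set.mem_ofPred_eq, weight_cons, hw])
          | zero => simp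
          | add x y _ _ hx hy => rw [map_add]; exact Submodule.add_mem _ hx hy
          | smul c x _ hx => rw [map_smul]; exact Submodule.smul_mem _ _ hx
  rw [Finsupp.supported_eq_span_single] at hmem
  generalize arb r k d S = x at hmem
  induction hmem using Submodule.span_induction with
  | mem x hx =>
    obtain ⟨w, hw, rfl⟩ := hx
    rw [factorOp_single, hw]
  | zero => simp
  | add x y _ _ hx hy => rw [map_add, map_add, hx, hy, TensorProduct.map_add_right]
  | smul c x _ hx => rw [map_smul, map_smul, hx, TensorProduct.map_smul_right]

/-- The contribution of the ordered partition `L` to both sides: the tensor product of the word of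
`L` and of the product of the arborifications of its blocks. -/
def partitionTensor (L : List (Finset V)) : WordSpace k Ω ⊗[k] WordSpace k Ω :=
  blocksWord k d L ⊗ₜ[k]
    L.foldr (fun A => quasiShuffle k (arb r k d A)) (Finsupp.single [] 1)

/-- The decomposition coproduct of an arborification: the first factors are the upper sets `U`, and
the empty one does not contribute. -/
theorem wordGamma_arb (S : Finset V) :
    wordGamma k Ω (arb r k d S) =
      ∑ L ∈ orderedPartitions (IsUp r) S, partitionTensor r k d L := by
  induction S using Finset.strongInduction with
  | H S ih =>
    rcases S.eq_empty_or_nonempty with rfl | hS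
    · rw [arb_empty, orderedPartitions_empty, Finset.sum_singleton]
      simp [wordGamma, wordGammaBasis_nil, partitionTensor, blocksWord]
    · have h1 : wordGamma k Ω (arb r k d S) =
          TensorProduct.lift ((factorOp k).compl₂ (wordGamma k Ω))
            (deconcat k (arb r k d S)) := by
        rw [arb_of_nonempty r k d hS]
        simp only [map_sum]
        exact Finset.sum_congr rfl fun A _ => wordGamma_prependZ k _ _
      rw [h1, deconcat_arb, map_sum, sum_orderedPartitions hS,
        ← Finset.insert_erase (empty_mem_firstBlocks_isUp (r := r) S),
        Finset.sum_insert (Finset.notMem_erase _ _), Finset.erase_insert_eq_erase,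
        Finset.erase_idem, TensorProduct.lift.tmul, LinearMap.compl₂_apply, arb_empty,
        factorOp_nil, LinearMap.zero_apply, zero_add]
      refine Finset.sum_congr rfl fun U hU => ?_
      rw [Finset.mem_erase, mem_firstBlocks] at hU
      rw [TensorProduct.lift.tmul, LinearMap.compl₂_apply, factorOp_arb,
        ih _ (Finset.sdiff_ssubset hU.2.1 (Finset.nonempty_iff_ne_empty.2 hU.1)), map_sum]
      rfl

/-- If `r` does not relate different blocks of an ordered partition, the arborification is the
product of those of the blocks. -/
theorem arb_eq_foldr {ok : Finset V → Finset V → Prop} (L : List (Finset V)) {S : Finset V}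
    (hL : L ∈ orderedPartitions ok S) (h : ∀ A ∈ L, ∀ u v, r u v → (u ∈ A ↔ v ∈ A)) :
    arb r k d S = L.foldr (fun A => quasiShuffle k (arb r k d A)) (Finsupp.single [] 1) := by
  induction L generalizing S with
  | nil => rw [nil_mem_orderedPartitions.1 hL, arb_empty]; rfl
  | cons A L ih =>
    obtain ⟨-, hAS, -, hL'⟩ := cons_mem_orderedPartitions.1 hL
    rw [List.foldr_cons, ← ih hL' fun B hB => h B (List.mem_cons_of_mem _ hB),
      ← arb_union k d Finset.disjoint_sdiff, Finset.union_sdiff_of_subset hAS]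
    intro u hu v hv
    have hv := (Finset.mem_sdiff.1 hv).2
    exact ⟨fun huv => hv ((h A (by simp) u v huv).1 hu),
      fun huv => hv ((h A (by simp) v u huv).2 hu)⟩

end GammaArb

/-! ### Ordered partitions and surjections -/

section Surjections

open Classical

variable {V : Type*}

/-- Ordered partitions are the lists of fibres of functions numbering the blocks. -/
theorem mem_orderedPartitions_iff {ok : Finset V → Finset V → Prop} (L : List (Finset V))
    (S : Finset V) :
    L ∈ orderedPartitions ok S ↔ ∃ g : V → ℕ, (∀ v ∈ S, g v < L.length) ∧
      ∀ j (hj : j < L.length), L[j] = S.filter (g · = j) ∧ L[j] ≠ ∅ ∧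
        ok L[j] (S.filter (j ≤ g ·)) := by
  induction L generalizing S with
  | nil =>
    rw [nil_mem_orderedPartitions]
    simp [Finset.eq_empty_iff_forall_notMem]
  | cons A L ih =>
    rw [cons_mem_orderedPartitions, ih]
    constructor
    · rintro ⟨hne, hAS, hok, g, hlt, hg⟩
      -- The first block gets the number `0` and the numbers of the others are shifted by one.
      refine ⟨fun v => if v ∈ A then 0 else g v + 1, fun v hv => ?_, fun j hj => ?_⟩
      · by_cases hvA : v ∈ A
        · simp [hvA]
        · simpa [hvA] using hlt v (Finset.mem_sdiff.2 ⟨hv, hvA⟩)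
      · cases j with
        | zero =>
          have h1 : S.filter (fun v => (if v ∈ A then 0 else g v + 1) = 0) = A := by
            ext v
            by_cases hvA : v ∈ A <;> simp [hvA]
            exact hAS hvA
          simp only [List.getElem_cons_zero, zero_le, Finset.filter_true]
          exact ⟨h1.symm, hne, hok⟩
        | succ j =>
          obtain ⟨h1, h2, h3⟩ := hg j (by simpa using hj)
          have h4 : S.filter (fun v => (if v ∈ A then 0 else g v + 1) = j + 1) =
              (S \ A).filter (g · = j) := by
            ext v
            by_cases hvA : v ∈ A <;> simp [hvA]
          have h5 : S.filter (fun v => j + 1 ≤ (if v ∈ A then 0 else g v + 1)) =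
              (S \ A).filter (j ≤ g ·) := by
            ext v
            by_cases hvA : v ∈ A <;> simp [hvA]
          simp only [List.getElem_cons_succ]
          rw [h4, h5]
          exact ⟨h1, h2, h3⟩
    · rintro ⟨g, hlt, hg⟩
      obtain ⟨h1, h2, h3⟩ := hg 0 (by simp)
      simp only [List.getElem_cons_zero, zero_le, Finset.filter_true] at h1 h2 h3
      have hA : ∀ v, v ∈ A ↔ v ∈ S ∧ g v = 0 := fun v => by
        rw [h1, Finset.mem_filter]
      refine ⟨h2, fun v hv => ((hA v).1 hv).1, h3, fun v => g v - 1, fun v hv => ?_,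
        fun j hj => ?_⟩
      · rw [Finset.mem_sdiff, hA] at hv
        have := hlt v hv.1
        rw [List.length_cons] at this
        have h0 : g v ≠ 0 := fun h => hv.2 ⟨hv.1, h⟩
        show g v - 1 < L.length
        omega
      · obtain ⟨h4, h5, h6⟩ := hg (j + 1) (by simpa using hj)
        simp only [List.getElem_cons_succ] at h4 h5 h6
        have h7 : S.filter (g · = j + 1) = (S \ A).filter (g · - 1 = j) := by
          ext v
          simp only [Finset.mem_filter, Finset.mem_sdiff, hA]
          constructor
          · rintro ⟨h, h'⟩
            exact ⟨⟨h, by omega⟩, by omega⟩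
          · rintro ⟨⟨h, h'⟩, h''⟩
            have : g v ≠ 0 := fun h0 => h' ⟨h, h0⟩
            exact ⟨h, by omega⟩
        have h8 : S.filter (j + 1 ≤ g ·) = (S \ A).filter (j ≤ g · - 1) := by
          ext v
          simp only [Finset.mem_filter, Finset.mem_sdiff, hA]
          constructor
          · rintro ⟨h, h'⟩
            exact ⟨⟨h, by omega⟩, by omega⟩
          · rintro ⟨⟨h, h'⟩, h''⟩
            have : g v ≠ 0 := fun h0 => h' ⟨h, h0⟩
            exact ⟨h, by omega⟩
        rw [← h7, ← h8]
        exact ⟨h4, h5, h6⟩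

variable [Fintype V]

/-- The list of the fibres of a function to `Fin s`. -/
def fibers {s : ℕ} (f : V → Fin s) : List (Finset V) :=
  List.ofFn fun j => Finset.univ.filter (f · = j)

theorem fibers_mem_orderedPartitions {ok : Finset V → Finset V → Prop} {s : ℕ} {f : V → Fin s} :
    fibers f ∈ orderedPartitions ok Finset.univ ↔ Function.Surjective f ∧
      ∀ j, ok (Finset.univ.filter (f · = j)) (Finset.univ.filter (j ≤ f ·)) := by
  rw [mem_orderedPartitions_iff]
  simp only [fibers, List.length_ofFn, List.getElem_ofFn, Finset.mem_univ, forall_true_left]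
  constructor
  · rintro ⟨g, -, h⟩
    have hg : ∀ v, g v = f v := by
      intro v
      have hv : v ∈ Finset.univ.filter (f · = f v) := by simp
      have h1 := (h (f v) (f v).2).1
      rw [Fin.eta] at h1
      rw [h1] at hv
      exact (Finset.mem_filter.1 hv).2
    simp only [hg] at h
    constructor
    · intro j
      obtain ⟨v, hv⟩ := Finset.nonempty_iff_ne_empty.2 (h j j.2).2.1
      exact ⟨v, (Finset.mem_filter.1 hv).2⟩
    · exact fun j => (h j j.2).2.2
  · rintro ⟨hf, h⟩
    refine ⟨fun v => f v, fun v => (f v).2, fun j hj => ⟨?_, ?_, h ⟨j, hj⟩⟩⟩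
    · ext v
      simp [Fin.ext_iff]
    · obtain ⟨v, hv⟩ := hf ⟨j, hj⟩
      exact Finset.nonempty_iff_ne_empty.1 ⟨v, by simpa using hv⟩

theorem fibers_injective {s : ℕ} : Function.Injective (fibers (V := V) (s := s)) := by
  intro f f' h
  have h := List.ofFn_injective h
  funext v
  have hv : v ∈ Finset.univ.filter (f · = f v) := by simp
  have h1 := congrFun h (f v)
  rw [h1] at hv
  exact (Finset.mem_filter.1 hv).2.symm

theorem exists_fibers_eq {ok : Finset V → Finset V → Prop} {L : List (Finset V)}
    (hL : L ∈ orderedPartitions ok Finset.univ) : ∃ f : V → Fin L.length, fibers f = L := by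
  obtain ⟨g, hlt, hg⟩ := (mem_orderedPartitions_iff L _).1 hL
  refine ⟨fun v => ⟨g v, hlt v (Finset.mem_univ v)⟩, ?_⟩
  refine List.ext_getElem (by simp [fibers]) fun j hj hj' => ?_
  rw [(hg j hj').1]
  simp [fibers, Fin.ext_iff]

/-- Summing over the admissible ordered partitions is summing over any family `X s` which
parametrizes bijectively the admissible surjections to `Fin s`. -/
theorem sum_fibers {M : Type*} [AddCommMonoid M] {ok : Finset V → Finset V → Prop}
    {X : ℕ → Type*} [∀ s, Fintype (X s)] (toFun : ∀ s, X s → V → Fin s)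
    (hinj : ∀ s, Function.Injective (toFun s))
    (hrange : ∀ s f, (∃ x, toFun s x = f) ↔ Function.Surjective f ∧
      ∀ j, ok (Finset.univ.filter (f · = j)) (Finset.univ.filter (j ≤ f ·)))
    (G : List (Finset V) → M) :
    ∑ s ∈ Finset.range (Fintype.card V + 1), ∑ x : X s, G (fibers (toFun s x)) =
      ∑ L ∈ orderedPartitions ok Finset.univ, G L := by
  rw [Finset.sum_sigma']
  refine Finset.sum_bij (fun p _ => fibers (toFun p.1 p.2)) ?_ ?_ ?_ fun _ _ => rfl
  · rintro ⟨s, x⟩ _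
    exact fibers_mem_orderedPartitions.2 ((hrange s _).1 ⟨x, rfl⟩)
  · rintro ⟨s, x⟩ _ ⟨t, y⟩ _ h
    obtain rfl : s = t := by simpa [fibers] using congrArg List.length h
    obtain rfl : x = y := hinj s (fibers_injective h)
    rfl
  · intro L hL
    obtain ⟨f, hf⟩ := exists_fibers_eq hL
    have hf' := fibers_mem_orderedPartitions.1 (hf.symm ▸ hL)
    obtain ⟨x, hx⟩ := (hrange _ f).2 hf'
    refine ⟨⟨L.length, x⟩, ?_, by simp only [hx, hf]⟩
    have := Fintype.card_le_of_surjective f hf'.1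
    rw [Fintype.card_fin] at this
    simp only [Finset.mem_sigma, Finset.mem_range, Finset.mem_univ, and_true]
    omega

variable (r : V → V → Prop)

theorem isTop_fibers {s : ℕ} (f : V → Fin s) :
    (∀ j, IsTop r (Finset.univ.filter (f · = j)) (Finset.univ.filter (j ≤ f ·))) ↔
      ∀ u v, r u v → f v < f u := by
  constructor
  · intro h u v huv
    by_contra hlt
    exact h (f u) u (by simp) v (by simpa using hlt) huv
  · intro h j u hu v hv huv
    simp only [Finset.mem_filter, Finset.mem_univ, true_and] at hu hv
    subst hu
    exact (h u v huv).not_ge hv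

theorem isUp_fibers {s : ℕ} (f : V → Fin s) :
    (∀ j, IsUp r (Finset.univ.filter (f · = j)) (Finset.univ.filter (j ≤ f ·))) ↔
      ∀ u v, r u v → f v ≤ f u := by
  constructor
  · intro h u v huv
    rcases le_total (f v) (f u) with hle | hle
    · exact hle
    · exact (Finset.mem_filter.1 (h (f u) u (by simp) v (by simpa using hle) huv)).2.le
  · intro h j u hu v hv huv
    simp only [Finset.mem_filter, Finset.mem_univ, true_and] at hu hv ⊢
    subst hu
    exact (h u v huv).antisymm hv

end Surjections

theorem blocksWord_ofFn {V : Type*} (k : Type*) [Field k] {Ω : Type*} [AddCommSemigroup Ω]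
    (d : V → Ω) {s : ℕ} (B : Fin s → Finset V) (φ : Fin s → Ω)
    (h : ∀ j, (φ j : WithZero Ω) = blockWeight d (B j)) :
    blocksWord k d (List.ofFn B) = Finsupp.single (List.ofFn φ) 1 := by
  induction s with
  | zero => rfl
  | succ s ih =>
    have := ih (fun j => B j.succ) (fun j => φ j.succ) fun j => h j.succ
    rw [List.ofFn_succ, List.ofFn_succ, ← prepend_single, ← this, ← prependZ_coe, h 0]
    rfl

open Classical in
theorem blockWeight_fiber_comp {V Q : Type*} [Fintype V] [Fintype Q] {Ω : Type*}
    [AddCommSemigroup Ω] (d : V → Ω) (π : V → Q) {d' : Q → Ω} {s : ℕ} (τ : Q → Fin s)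
    (h : ∀ A, (d' A : WithZero Ω) = blockWeight d (Finset.univ.filter (π · = A))) (j : Fin s) :
    blockWeight d' (Finset.univ.filter (τ · = j)) =
      blockWeight d (Finset.univ.filter fun v => τ (π v) = j) := by
  rw [blockWeight, blockWeight, ← Finset.sum_fiberwise_of_maps_to (g := π)
    (t := Finset.univ.filter (τ · = j)) (by simp)]
  refine Finset.sum_congr rfl fun A hA => (h A).trans (Finset.sum_congr ?_ fun _ _ => rfl)
  ext v
  simp only [Finset.mem_filter, Finset.mem_univ, true_and] at hA ⊢
  exact ⟨fun h => ⟨h ▸ hA, h⟩, fun h => h.2⟩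

namespace DecForest

variable {Ω : Type*}

/-! ### Linear extensions of forests -/

theorem lt_of_edge_imp (F : DecForest Ω) {s : ℕ} {f : F.V → Fin s}
    (h : ∀ u v, F.edge u v → f v < f u) (u v : F.V) (huv : F.lt u v) : f v < f u := by
  induction huv with
  | single h' => exact h _ _ h'
  | tail _ h' ih => exact (h _ _ h').trans ih

theorem isEmpty_linExt (F : DecForest Ω) {s : ℕ} (hs : Fintype.card F.V < s) :
    IsEmpty (F.LinExt s) := by
  refine ⟨fun σ => ?_⟩
  have := Fintype.card_le_of_surjective _ σ.surjective
  rw [Fintype.card_fin] at this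
  omega

/-- The covering subforest whose blocks are the connected components of the fibres of `f`. -/
def fiberCovering (F : DecForest Ω) {s : ℕ} (f : F.V → Fin s) : F.Covering where
  rel := Relation.EqvGen.setoid fun a b => F.edge a b ∧ f a = f b
  connected _ _ h :=
    Relation.EqvGen.mono (fun _ _ hab => ⟨hab.1, Relation.EqvGen.rel _ _ hab⟩) _ _ h

theorem fiberCovering_apply_eq (F : DecForest Ω) {s : ℕ} (f : F.V → Fin s) {u v : F.V}
    (h : (F.fiberCovering f).rel u v) : f u = f v := by
  have h' : Relation.EqvGen (fun a b => F.edge a b ∧ f a = f b) u v := h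
  clear h
  induction h' with
  | rel a b h => exact h.2
  | refl a => rfl
  | symm a b _ ih => exact ih.symm
  | trans a b c _ _ ih ih' => exact ih.trans ih'

variable [AddCommSemigroup Ω]

theorem coe_blockSum {V : Type*} (d : V → Ω) (S : Finset V) (hS : S.Nonempty) :
    ((blockSum d S hS : Ω) : WithZero Ω) = blockWeight d S := WithZero.coe_unzero _

variable (k : Type*) [Field k]

/-- Any large enough bound on the number of letters gives the arborification; this allows the same
bound for all contractions of a forest. -/
theorem arborify_eq_sum_range (F : DecForest Ω) {N : ℕ} (hN : Fintype.card F.V < N) :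
    F.arborify k = ∑ s ∈ Finset.range N,
      ∑ σ : F.LinExt s, Finsupp.single (F.fiberWord σ.toFun σ.surjective) 1 := by
  refine Finset.sum_subset (Finset.range_mono hN) fun s _ hs => ?_
  rw [Finset.mem_range, not_lt] at hs
  have := F.isEmpty_linExt (s := s) (by omega)
  exact Fintype.sum_empty _

theorem arborify_eq_arb (F : DecForest Ω) :
    F.arborify k = arb F.edge k F.dec Finset.univ := by
  rw [arb, ← sum_fibers (X := F.LinExt) (fun _ σ => σ.toFun) (fun _ _ _ h => LinExt.ext h),
    arborify]
  · refine Finset.sum_congr rfl fun s _ => Finset.sum_congr rfl fun σ _ => ?_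
    symm
    exact blocksWord_ofFn k F.dec _ _ fun j => coe_blockSum _ _ _
  · intro s f
    rw [isTop_fibers]
    constructor
    · rintro ⟨σ, rfl⟩
      exact ⟨σ.surjective, fun u v h => σ.strict_mono u v (.single h)⟩
    · rintro ⟨hf, h⟩
      exact ⟨⟨f, hf, F.lt_of_edge_imp h⟩, rfl⟩

/-! ### Linear extensions of contracted forests -/

variable (F : DecForest Ω)

theorem LinExt.lt_of_edge {F : DecForest Ω} {r : F.Covering} {s : ℕ}
    (τ : (F.contract r).LinExt s) {u v : F.V} (huv : F.edge u v) (hr : ¬ r.rel u v) :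
    τ.toFun (Quotient.mk r.rel v) < τ.toFun (Quotient.mk r.rel u) :=
  τ.strict_mono (Quotient.mk r.rel u) (Quotient.mk r.rel v)
    (.single ⟨fun h => hr (Quotient.exact h), u, v, rfl, rfl, huv⟩)

theorem LinExt.le_of_edge {F : DecForest Ω} {r : F.Covering} {s : ℕ}
    (τ : (F.contract r).LinExt s) {u v : F.V} (huv : F.edge u v) :
    τ.toFun (Quotient.mk r.rel v) ≤ τ.toFun (Quotient.mk r.rel u) := by
  by_cases hr : r.rel u v
  · exact (congrArg τ.toFun (Quotient.sound hr)).ge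
  · exact (τ.lt_of_edge huv hr).le

/-- The function on the vertices of `F` induced by a linear extension of a contraction of `F`. -/
def pullLinExt (s : ℕ) (p : Σ r : F.Covering, (F.contract r).LinExt s) (v : F.V) : Fin s :=
  p.2.toFun (Quotient.mk p.1.rel v)

/-- The blocks are recovered from the induced function: they are the connected components of its
fibres. -/
theorem rel_iff_of_linExt {r : F.Covering} {s : ℕ} (τ : (F.contract r).LinExt s) (u v : F.V) :
    r.rel u v ↔ Relation.EqvGen
      (fun a b => F.edge a b ∧ F.pullLinExt s ⟨r, τ⟩ a = F.pullLinExt s ⟨r, τ⟩ b) u v := by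
  constructor
  · intro h
    refine Relation.EqvGen.mono (fun a b hab => ⟨hab.1, ?_⟩) _ _ (r.connected u v h)
    exact congrArg τ.toFun (Quotient.sound hab.2)
  · intro h
    induction h with
    | rel a b h =>
      by_contra hr
      exact (τ.lt_of_edge h.1 hr).ne' h.2
    | refl a => exact r.rel.refl a
    | symm a b _ ih => exact r.rel.symm ih
    | trans a b c _ _ ih ih' => exact r.rel.trans ih ih'

theorem pullLinExt_injective (s : ℕ) : Function.Injective (F.pullLinExt s) := by
  rintro ⟨r, τ⟩ ⟨r', τ'⟩ h
  obtain rfl : r = r' := by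
    refine Covering.ext (Setoid.ext fun u v => ?_)
    rw [F.rel_iff_of_linExt τ, F.rel_iff_of_linExt τ', h]
  obtain rfl : τ = τ' := by
    refine LinExt.ext (funext fun A => ?_)
    obtain ⟨v, rfl⟩ := Quotient.exists_rep A
    exact congrFun h v
  rfl

/-- The functions induced by linear extensions of contractions of `F` are the weakly monotone
surjections. -/
theorem exists_pullLinExt_eq {s : ℕ} (f : F.V → Fin s) :
    (∃ p, F.pullLinExt s p = f) ↔
      Function.Surjective f ∧ ∀ u v, F.edge u v → f v ≤ f u := by
  constructor
  · rintro ⟨⟨r, τ⟩, rfl⟩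
    exact ⟨τ.surjective.comp Quotient.mk_surjective, fun u v h => τ.le_of_edge h⟩
  · rintro ⟨hf, h⟩
    refine ⟨⟨F.fiberCovering f, Quotient.lift f fun _ _ => F.fiberCovering_apply_eq f, ?_,
      (F.contract (F.fiberCovering f)).lt_of_edge_imp ?_⟩, rfl⟩
    · intro j
      obtain ⟨v, hv⟩ := hf j
      exact ⟨Quotient.mk _ v, hv⟩
    · rintro A B ⟨hne, a, b, rfl, rfl, hab⟩
      refine lt_of_le_of_ne (h a b hab) fun hba => hne (Quotient.sound ?_)
      exact Relation.EqvGen.rel _ _ ⟨hab, hba.symm⟩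

/-! ### The extraction-contraction coproduct -/

/-- Summing decorations over blocks, then over a fibre, is summing them over the induced fibre. -/
theorem single_fiberWord_contract {r : F.Covering} {s : ℕ} (τ : (F.contract r).LinExt s) :
    Finsupp.single ((F.contract r).fiberWord τ.toFun τ.surjective) 1 =
      blocksWord k F.dec (fibers (F.pullLinExt s ⟨r, τ⟩)) := by
  symm
  refine blocksWord_ofFn k F.dec _ _ fun j => ?_
  refine (coe_blockSum _ _ _).trans ?_
  refine blockWeight_fiber_comp (Q := (F.contract r).V) (d' := (F.contract r).dec) F.dec
    (Quotient.mk r.rel) τ.toFun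
    (fun A => (coe_blockSum F.dec _ (F.class_nonempty r.rel A)).trans ?_) j
  -- The two sets differ only by the decidability instance for equality of blocks.
  congr

/-- A covering subforest is the disjoint union of the fibres of the induced function: an edge inside
a fibre joins vertices of the same block, as linear extensions are strict on contracted edges. -/
theorem arborify_subforest {r : F.Covering} {s : ℕ} (τ : (F.contract r).LinExt s) :
    (F.subforest r).arborify k =
      (fibers (F.pullLinExt s ⟨r, τ⟩)).foldr
        (fun A => quasiShuffle k (arb F.edge k F.dec A)) (Finsupp.single [] 1) := by
  classical
  have hmem : fibers (F.pullLinExt s ⟨r, τ⟩) ∈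
      orderedPartitions (IsUp F.edge) (Finset.univ : Finset F.V) := by
    rw [fibers_mem_orderedPartitions, isUp_fibers]
    exact (F.exists_pullLinExt_eq _).1 ⟨_, rfl⟩
  have hA : ∀ A ∈ fibers (F.pullLinExt s ⟨r, τ⟩), ∃ j, ∀ v,
      v ∈ A ↔ F.pullLinExt s ⟨r, τ⟩ v = j := by
    intro A hA
    obtain ⟨j, rfl⟩ := (List.mem_ofFn' _ _).1 hA
    exact ⟨j, fun v => by simp⟩
  rw [arborify_eq_arb k]
  refine (arb_eq_foldr (V := F.V) (fun u v => F.edge u v ∧ r.rel u v) k F.dec _ hmem ?_).trans ?_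
  · intro A hAL u v huv
    obtain ⟨j, hj⟩ := hA A hAL
    rw [hj, hj, pullLinExt, pullLinExt, Quotient.sound huv.2]
  · refine List.foldr_ext _ _ _ fun A hAL x => ?_
    obtain ⟨j, hj⟩ := hA A hAL
    rw [arb_congr k F.dec (r' := F.edge)]
    refine fun u hu v hv => and_iff_left_of_imp fun huv => ?_
    by_contra hr
    exact (τ.lt_of_edge huv hr).ne (((hj v).1 hv).trans ((hj u).1 hu).symm)

/-- The sum over the covering subforests and the linear extensions of the contracted forests, as a
sum over weakly monotone surjections. -/
theorem sum_covering_arborify :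
    ∑ r : F.Covering, (F.contract r).arborify k ⊗ₜ[k] (F.subforest r).arborify k =
      ∑ L ∈ orderedPartitions (IsUp F.edge) Finset.univ, partitionTensor F.edge k F.dec L := by
  classical
  rw [← sum_fibers (F.pullLinExt) F.pullLinExt_injective]
  · have h1 : ∀ r : F.Covering, (F.contract r).arborify k ⊗ₜ[k] (F.subforest r).arborify k =
        ∑ s ∈ Finset.range (Fintype.card F.V + 1), ∑ τ : (F.contract r).LinExt s,
          partitionTensor F.edge k F.dec (fibers (F.pullLinExt s ⟨r, τ⟩)) := by
      intro r
      have hcard : Fintype.card (F.contract r).V < Fintype.card F.V + 1 :=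
        Nat.lt_succ_of_le (Fintype.card_le_of_surjective (Quotient.mk r.rel)
          Quotient.mk_surjective)
      rw [arborify_eq_sum_range k _ hcard, TensorProduct.sum_tmul]
      refine Finset.sum_congr rfl fun s _ => ?_
      rw [TensorProduct.sum_tmul]
      refine Finset.sum_congr rfl fun τ _ => ?_
      rw [single_fiberWord_contract, F.arborify_subforest k τ]
      rfl
    rw [Finset.sum_congr rfl fun r _ => h1 r, Finset.sum_comm]
    exact Finset.sum_congr rfl fun s _ => (Fintype.sum_sigma fun p =>
      partitionTensor F.edge k F.dec (fibers (F.pullLinExt s p))).symm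
  · intro s f
    rw [isUp_fibers, exists_pullLinExt_eq]

end DecForest

end

end Arbo

/-! ### The compatibility of the two coproducts -/

theorem theorem5p1 {k : Type*} [Field k] {Ω : Type*} [AddCommSemigroup Ω] :
    Arbo.wordGamma k Ω ∘ₗ Arbo.arborification k Ω =
      TensorProduct.map (Arbo.arborification k Ω) (Arbo.arborification k Ω) ∘ₗ
        Arbo.forestGamma k Ω := by
  ext x : 2
  have harb : ∀ F : Arbo.DecForest Ω, Arbo.arborification k Ω
      (Finsupp.single (⟦F⟧ : Arbo.Forest Ω) 1) = F.arborify k := by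
    intro F
    simp [Arbo.arborification]
  obtain ⟨F, rfl⟩ := Quotient.exists_rep x
  have hΓ : Arbo.forestGamma k Ω (Finsupp.single (⟦F⟧ : Arbo.Forest Ω) 1) =
      Arbo.forestGammaAux k F := by
    simp [Arbo.forestGamma]
  rw [LinearMap.comp_apply, LinearMap.comp_apply, LinearMap.comp_apply, LinearMap.comp_apply,
    Finsupp.lsingle_apply, harb, hΓ, Arbo.forestGammaAux, map_sum, F.arborify_eq_arb k,
    Arbo.wordGamma_arb, ← F.sum_covering_arborify k]
  refine Finset.sum_congr rfl fun r _ => ?_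
  rw [TensorProduct.map_tmul, harb, harb]
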